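/- **Theorem 1.** Let $X$ be a locally compact Hausdorff space and let $\mathcal M(X)$ be the set of finite positive regular Radon measures on $X$. For $H\subset X$ let $\mathcal M(H)$ be the set of $\mu\in\mathcal M(X)$ that are concentrated on $H$, that is, such that $K\setminus H$ has outer $\mu$-measure zero for every compact $K\subset X$. Let $k:X\times X\to[0,\infty]$ be lower semicontinuous and symmetric. Integrals of lower semicontinuous functions $f:Z\to[0,\infty]$ are upper integrals, i.e. $\int f\,d\mu=\sup\{\int h\,d\mu: h\in C_c(Z),\ 0\le h\le f\}$. Write $$U^\mu(y)=\int_X k(x,y)\,d\mu(x),\qquad E(\mu,\nu)=\int_{X\times X}k\,d(\mu\times\nu),$$ and, for $\mathcal A,\mathcal B\subset\mathcal M(X)$, $$q(\mathcal A,\mathcal B)=\inf_{\mu\in\mathcal A}\sup_{\nu\in\mathcal B}E(\mu,\nu),\qquad \underline q(\mathcal A,\mathcal B)=\sup_{\mu\in\mathcal A}\inf_{\nu\in\mathcal B}E(\mu,\nu),$$ with infima and suprema taken in $[0,\infty]$ (so $\inf\emptyset=\infty$ and $\sup\emptyset=0$). Let $H,L\subset X$, let $\mathcal R(H),\mathcal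 S(H)\subset\mathcal M(H)$ be convex, and let $\tilde{\mathcal R}(L),\tilde{\mathcal S}(L)\subset\mathcal M(L)$ be convex and compact in the $w^*$-topology, meaning here the vague topology (the coarsest topology that makes $\mu\mapsto\int f\,d\mu$ continuous for every $f\in C_c(X)$). Assume that $\mathcal R(H)$ and $\tilde{\mathcal R}(L)$ are not both empty, and that $$\inf_{\nu\in\tilde{\mathcal R}(L)}\int_L U^\mu\,d\nu=\inf_{\nu\in\tilde{\mathcal S}(L)}\int_L U^\mu\,d\nu\qquad\text{for all }\mu\in\mathcal M(H),\tag{1}$$ $$\sup_{\nu\in\mathcal R(H)}\int_H U^\mu\,d\nu=\sup_{\nu\in\mathcal S(H)}\int_H U^\mu\,d\nu\qquad\text{for all }\mu\in\mathcal M(L).\tag{2}$$ Then $$\underline q\big(\mathcal R(H),\tilde{\mathcal S}(L)\big)=q\big(\tilde{\mathcal R}(L),\mathcal S(H)\big).$$ -/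

import Mathlib

open MeasureTheory Set
open scoped ENNReal NNReal CompactlySupported

noncomputable section

namespace RadonEnergy

/-- The finite (positive) regular Radon measures on the space `X` with its Borel `σ`-algebra. -/
def finiteRadon (X : Type*) [TopologicalSpace X] [MeasurableSpace X] : Set (Measure X) :=
  {μ | μ.Regular ∧ IsFiniteMeasure μ}

/-- `μ` is concentrated on `H` if every compact set meets the complement of `H` in a set of outer
measure zero (in Mathlib `μ A` is the outer measure of `A` when `A` is not measurable). -/
def IsConcentratedOn {X : Type*} [TopologicalSpace X] [MeasurableSpace X]
    (μ : Measure X) (H : Set X) : Prop :=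
  ∀ K : Set X, IsCompact K → μ (K ∩ Hᶜ) = 0

/-- The finite regular Radon measures on `X` that are concentrated on `H`. -/
def measuresOn {X : Type*} [TopologicalSpace X] [MeasurableSpace X] (H : Set X) :
    Set (Measure X) :=
  {μ | μ ∈ finiteRadon X ∧ IsConcentratedOn μ H}

/-- The vague topology: the coarsest one for which `μ ↦ ∫ f dμ` is continuous for every continuous
compactly supported `f : X → ℝ`. It is used only on sets of finite Radon measures, where all these
integrals converge. -/
@[reducible] def vagueTopology (X : Type*) [TopologicalSpace X] [MeasurableSpace X] :
    TopologicalSpace (Measure X) :=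
  TopologicalSpace.induced (fun (μ : Measure X) (f : C_c(X, ℝ)) => ∫ x, f x ∂μ) inferInstance

/-- Compactness in the vague topology. -/
def IsVaguelyCompact {X : Type*} [TopologicalSpace X] [MeasurableSpace X]
    (A : Set (Measure X)) : Prop :=
  @IsCompact (Measure X) (vagueTopology X) A

/-- The upper integral of a lower semicontinuous `f : Z → [0, ∞]`: the supremum of `∫ h dμ` over the
continuous compactly supported `h` with `0 ≤ h ≤ f`. -/
def upperIntegral {Z : Type*} [TopologicalSpace Z] [MeasurableSpace Z]
    (μ : Measure Z) (f : Z → ℝ≥0∞) : ℝ≥0∞ :=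
  ⨆ (h : C_c(Z, ℝ≥0)) (_ : ∀ z, (h z : ℝ≥0∞) ≤ f z), ∫⁻ z, (h z : ℝ≥0∞) ∂μ

variable {X Y : Type*} [TopologicalSpace X] [MeasurableSpace X]
  [TopologicalSpace Y] [MeasurableSpace Y]

/-- The mutual energy `E(μ, ν)` of `μ` and `ν` with respect to the kernel `k`. -/
def energy (k : X × Y → ℝ≥0∞) (μ : Measure X) (ν : Measure Y) : ℝ≥0∞ :=
  upperIntegral (μ.prod ν) k

/-- The potential `U^μ(y) = ∫ k(x, y) dμ(x)`. -/
def potential (k : X × Y → ℝ≥0∞) (μ : Measure X) (y : Y) : ℝ≥0∞ :=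
  upperIntegral μ fun x => k (x, y)

/-- The inf–sup energy `q(R, S)`. -/
def infSupEnergy (k : X × Y → ℝ≥0∞) (R : Set (Measure X)) (S : Set (Measure Y)) : ℝ≥0∞ :=
  ⨅ μ ∈ R, ⨆ ν ∈ S, energy k μ ν

/-- The sup–inf energy. -/
def supInfEnergy (k : X × Y → ℝ≥0∞) (R : Set (Measure X)) (S : Set (Measure Y)) : ℝ≥0∞ :=
  ⨆ μ ∈ R, ⨅ ν ∈ S, energy k μ ν

end RadonEnergy

end

/-! By Fubini, `∫ U^μ dν = E(μ, ν)`, so (1) replaces `S'` by `R'` on the sup-inf side and (2), with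
the symmetry of `k`, replaces `S` by `R` on the inf-sup side. What remains is the minimax identity
`sup_R inf_R' E = inf_R' sup_R E` (`minimax_energy`).

As `k` may be infinite and discontinuous, `E` is written as the supremum of the directed family of
energies of the minorants `h ∈ C_c` of `k`; each is finite, biaffine and vaguely continuous in `ν`.
If `c < inf sup`, compactness of `R'` leaves finitely many pairs `(h, μ_i)`, and directedness leaves
a single `h`. Separating the convex set of energy vectors from the orthant below `c`
(`exists_weights_of_convex`) gives weights whose average of the `μ_i` has energy at least `c`
against every `ν` (`iInf_iSup_le_iSup_iInf`). -/

noncomputable section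

namespace RadonEnergy

/-! ### Upper integrals and directed suprema -/

section Dini

variable {Z : Type*} [TopologicalSpace Z]

/-- A one-sided Dini theorem: a compactly supported continuous minorant of the supremum of a
directed family of lower semicontinuous functions is, up to `ε`, a minorant of a member. -/
lemma exists_le_add_of_le_iSup {ι : Type*} [Nonempty ι] {F : ι → Z → ℝ≥0∞}
    (hF : ∀ i, LowerSemicontinuous (F i)) (hdir : Directed (· ≤ ·) F) (g : C_c(Z, ℝ≥0))
    (hg : ∀ z, (g z : ℝ≥0∞) ≤ ⨆ i, F i z) {ε : ℝ≥0∞} (hε : ε ≠ 0) :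
    ∃ i, ∀ z, (g z : ℝ≥0∞) ≤ F i z + ε := by
  have hcont : Continuous fun z => (g z : ℝ≥0∞) :=
    ENNReal.continuous_coe.comp g.continuous
  obtain ⟨i, hi⟩ := g.hasCompactSupport.isCompact.elim_directed_cover
    (fun i => {z | (g z : ℝ≥0∞) < F i z + ε}) (fun i => by
      have h1 : LowerSemicontinuous fun z => F i z + ε := by
        have : LowerSemicontinuous fun _ : Z => ε := lowerSemicontinuous_const
        exact (hF i).add this
      rw [isOpen_iff_mem_nhds]
      intro z hz
      obtain ⟨c, hc1, hc2⟩ := exists_between (show (g z : ℝ≥0∞) < F i z + ε from hz)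
      filter_upwards [h1 z c hc2, hcont.continuousAt.eventually_lt continuousAt_const hc1]
        with w hw1 hw2 using hw2.trans hw1)
    -- If no index worked at `z`, then `sup F + ε ≤ g z ≤ sup F`, impossible since `g z` is finite.
    (fun z _ => by
      simp only [mem_iUnion, mem_ofPred_eq]
      by_contra! hcon
      have h2 : (⨆ i, F i z) + ε ≤ g z := by
        rw [ENNReal.iSup_add]
        exact iSup_le hcon
      exact absurd ((ENNReal.lt_add_right (ENNReal.coe_ne_top (r := g z)) hε).trans_le
        (by gcongr; exact hg z)) (not_lt.2 h2))
    (hdir.mono_comp (g := fun f : Z → ℝ≥0∞ => {z | (g z : ℝ≥0∞) < f z + ε}) _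
      (fun f f' hff z hz => lt_of_lt_of_le (show (g z : ℝ≥0∞) < f z + ε from hz)
        (by gcongr; exact hff z)))
  refine ⟨i, fun z => ?_⟩
  by_cases hz : z ∈ tsupport g
  · exact le_of_lt (hi hz)
  · simp [image_eq_zero_of_notMem_tsupport hz]

/-- The continuous compactly supported functions below `f`. -/
abbrev Minorant (f : Z → ℝ≥0∞) : Type _ := {h : C_c(Z, ℝ≥0) // ∀ z, (h z : ℝ≥0∞) ≤ f z}

instance (f : Z → ℝ≥0∞) : Nonempty (Minorant f) := ⟨⟨0, by simp⟩⟩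

instance (f : Z → ℝ≥0∞) : IsDirectedOrder (Minorant f) where
  directed a b := ⟨⟨a.1 ⊔ b.1, fun z => by
    simpa using ⟨a.2 z, b.2 z⟩⟩, Subtype.coe_le_coe.1 le_sup_left, Subtype.coe_le_coe.1 le_sup_right⟩

/-- On a locally compact space, a lower semicontinuous function is the supremum of its continuous
compactly supported minorants. -/
lemma iSup_minorant [LocallyCompactSpace Z] [T2Space Z] {f : Z → ℝ≥0∞}
    (hf : LowerSemicontinuous f) (z : Z) : ⨆ h : Minorant f, (h.1 z : ℝ≥0∞) = f z := by
  refine le_antisymm (iSup_le fun h => h.2 z) (ENNReal.le_of_forall_nnreal_lt fun t ht => ?_)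
  have hU : IsOpen {w | (t : ℝ≥0∞) < f w} := hf.isOpen_preimage t
  -- The minorant is `t` times an Urysohn function equal to `1` at `z` and `0` off `{f > t}`.
  obtain ⟨p, hp1, hp0, hpc, hpI⟩ := exists_continuous_one_zero_of_isCompact
    (isCompact_singleton (x := z)) hU.isClosed_compl
    (by simpa [disjoint_compl_right_iff_subset] using ht)
  let h : C_c(Z, ℝ≥0) := t • (⟨p, hpc⟩ : C_c(Z, ℝ)).nnrealPart
  have hh : ∀ w, h w = t * (p w).toNNReal := fun w => rfl
  have hle : ∀ w, (h w : ℝ≥0∞) ≤ f w := by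
    intro w
    rw [hh]
    by_cases hw : w ∈ {w | (t : ℝ≥0∞) < f w}
    · refine le_trans ?_ (le_of_lt hw)
      have : (p w).toNNReal ≤ 1 := Real.toNNReal_le_one.2 (hpI w).2
      exact_mod_cast mul_le_of_le_one_right' this
    · have := hp0 hw
      simp only [Pi.zero_apply] at this
      simp [this]
  refine le_iSup_of_le (⟨h, hle⟩ : Minorant f) ?_
  have := hp1 (mem_singleton z)
  simp only [Pi.one_apply] at this
  simp [hh, this]

lemma upperIntegral_eq_iSup [MeasurableSpace Z] (μ : Measure Z) (f : Z → ℝ≥0∞) :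
    upperIntegral μ f = ⨆ h : Minorant f, ∫⁻ z, (h.1 z : ℝ≥0∞) ∂μ := by
  rw [upperIntegral, iSup_subtype]

/-- Monotone convergence for the upper integral along directed families. -/
lemma upperIntegral_iSup_le [MeasurableSpace Z] (μ : Measure Z) [IsFiniteMeasure μ]
    {ι : Type*} [Nonempty ι] {F : ι → Z → ℝ≥0∞}
    (hF : ∀ i, LowerSemicontinuous (F i)) (hdir : Directed (· ≤ ·) F) :
    upperIntegral μ (fun z => ⨆ i, F i z) ≤ ⨆ i, ∫⁻ z, F i z ∂μ := by
  refine iSup₂_le fun g hg => ENNReal.le_of_forall_pos_le_add fun ε hε _ => ?_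
  obtain ⟨δ, hδ, hδε⟩ : ∃ δ : ℝ≥0, 0 < δ ∧ (δ : ℝ≥0∞) * μ univ ≤ ε := by
    -- The `+ 1` keeps the quotient positive when `μ = 0`.
    refine ⟨ε / ((μ univ).toNNReal + 1), by positivity, ?_⟩
    have hm : μ univ = ((μ univ).toNNReal : ℝ≥0∞) :=
      (ENNReal.coe_toNNReal (measure_ne_top μ univ)).symm
    generalize (μ univ).toNNReal = m at hm
    rw [hm, ← ENNReal.coe_mul, ENNReal.coe_le_coe, div_mul_eq_mul_div]
    refine div_le_of_le_mul₀ (by positivity) (by positivity) ?_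
    gcongr
    simp
  obtain ⟨i, hi⟩ := exists_le_add_of_le_iSup hF hdir g hg (ENNReal.coe_ne_zero.2 hδ.ne')
  calc ∫⁻ z, (g z : ℝ≥0∞) ∂μ ≤ ∫⁻ z, (F i z + δ) ∂μ := lintegral_mono hi
    _ = ∫⁻ z, F i z ∂μ + δ * μ univ := by
      rw [lintegral_add_right _ measurable_const, lintegral_const]
    _ ≤ (⨆ i, ∫⁻ z, F i z ∂μ) + ε := by
      gcongr
      exact le_iSup (fun i => ∫⁻ z, F i z ∂μ) i

end Dini

lemma exists_forall_le {Z : Type*} [TopologicalSpace Z] (h : C_c(Z, ℝ≥0)) :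
    ∃ C : ℝ≥0, ∀ z, h z ≤ C := by
  obtain ⟨C, hC⟩ := h.toReal.hasCompactSupport.exists_bound_of_continuous h.toReal.continuous
  refine ⟨C.toNNReal, fun z => NNReal.le_toNNReal_of_coe_le ?_⟩
  simpa using hC z

lemma lintegral_coe_lt_top {Z : Type*} [TopologicalSpace Z] [MeasurableSpace Z]
    (μ : Measure Z) [IsFiniteMeasure μ] (h : C_c(Z, ℝ≥0)) : ∫⁻ z, (h z : ℝ≥0∞) ∂μ < ∞ := by
  obtain ⟨C, hC⟩ := exists_forall_le h
  refine (lintegral_mono (g := fun _ => (C : ℝ≥0∞)) fun z => ENNReal.coe_le_coe.2 (hC z)).trans_lt ?_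
  rw [lintegral_const]
  exact ENNReal.mul_lt_top ENNReal.coe_lt_top (measure_lt_top μ univ)

/-- Without second countability the product σ-algebra, on which `μ.prod ν` lives, may be smaller
than the Borel one. Compact support still gives measurability, hence Tonelli. -/
lemma measurable_coe_prod {X Y : Type*} [TopologicalSpace X] [MeasurableSpace X]
    [OpensMeasurableSpace X] [TopologicalSpace Y] [MeasurableSpace Y] [OpensMeasurableSpace Y]
    (h : C_c(X × Y, ℝ≥0)) : Measurable fun z => (h z : ℝ≥0∞) :=
  (h.hasCompactSupport.measurable_of_prod h.continuous).coe_nnreal_ennreal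

lemma lintegral_slice_lt_top {X Y : Type*} [TopologicalSpace X] [MeasurableSpace X]
    [TopologicalSpace Y] (h : C_c(X × Y, ℝ≥0)) (μ : Measure X) [IsFiniteMeasure μ] (y : Y) :
    ∫⁻ x, (h (x, y) : ℝ≥0∞) ∂μ < ∞ := by
  obtain ⟨C, hC⟩ := exists_forall_le h
  refine (lintegral_mono (g := fun _ => (C : ℝ≥0∞)) fun x =>
    ENNReal.coe_le_coe.2 (hC (x, y))).trans_lt ?_
  rw [lintegral_const]
  exact ENNReal.mul_lt_top ENNReal.coe_lt_top (measure_lt_top μ univ)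

/-! ### Partial integrals, potentials and Fubini -/

section Slice

variable {X Y : Type*} [TopologicalSpace X] [MeasurableSpace X] [OpensMeasurableSpace X]
  [TopologicalSpace Y] [T2Space Y]

/-- The section `x ↦ h (x, y)`. -/
def slice [T2Space X] (h : C_c(X × Y, ℝ≥0)) (y : Y) : C_c(X, ℝ≥0) where
  toFun x := h (x, y)
  continuous_toFun := by fun_prop
  hasCompactSupport' := by
    refine HasCompactSupport.intro (h.hasCompactSupport.isCompact.image continuous_fst)
      fun x hx => ?_
    refine image_eq_zero_of_notMem_tsupport fun hxy => hx ⟨(x, y), hxy, rfl⟩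

/-- The partial integral `y ↦ ∫ h (x, y) dμ(x)`. -/
def partialIntegral (h : C_c(X × Y, ℝ≥0)) (μ : Measure X) [IsFiniteMeasure μ] : C_c(Y, ℝ≥0) where
  toFun y := (∫⁻ x, (h (x, y) : ℝ≥0∞) ∂μ).toNNReal
  continuous_toFun := by
    have key : Continuous fun y => ∫ x, (h (x, y) : ℝ) ∂μ := by
      rw [← continuousOn_univ]
      refine continuousOn_integral_of_compact_support (f := fun y x => (h (x, y) : ℝ))
        (h.hasCompactSupport.isCompact.image continuous_fst) (Continuous.continuousOn ?_) ?_
      · change Continuous fun p : Y × X => (h (p.2, p.1) : ℝ)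
        fun_prop
      · intro y x _ hx
        rw [image_eq_zero_of_notMem_tsupport fun hxy => hx ⟨(x, y), hxy, rfl⟩, NNReal.coe_zero]
    have heq : (fun y => (∫⁻ x, (h (x, y) : ℝ≥0∞) ∂μ).toNNReal) =
        fun y => (∫ x, (h (x, y) : ℝ) ∂μ).toNNReal := by
      ext y
      have hm : AEMeasurable (fun x => (h (x, y) : ℝ≥0∞)) μ :=
        (by fun_prop : Continuous fun x => (h (x, y) : ℝ≥0∞)).measurable.aemeasurable
      have := integral_toReal hm (by simp)
      simp only [ENNReal.coe_toReal] at this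
      rw [this]
      simp [ENNReal.toReal]
    rw [heq]
    exact continuous_real_toNNReal.comp key
  hasCompactSupport' := by
    refine HasCompactSupport.intro (h.hasCompactSupport.isCompact.image continuous_snd)
      fun y hy => ?_
    have : ∀ x, h (x, y) = 0 := fun x =>
      image_eq_zero_of_notMem_tsupport fun hxy => hy ⟨(x, y), hxy, rfl⟩
    simp [this]

lemma coe_partialIntegral (h : C_c(X × Y, ℝ≥0)) (μ : Measure X) [IsFiniteMeasure μ] (y : Y) :
    (partialIntegral h μ y : ℝ≥0∞) = ∫⁻ x, (h (x, y) : ℝ≥0∞) ∂μ :=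
  ENNReal.coe_toNNReal (lintegral_slice_lt_top h μ y).ne

lemma lintegral_prod_eq [MeasurableSpace Y] [OpensMeasurableSpace Y] (h : C_c(X × Y, ℝ≥0))
    (μ : Measure X) (ν : Measure Y) [IsFiniteMeasure μ] [IsFiniteMeasure ν] :
    ∫⁻ z, (h z : ℝ≥0∞) ∂(μ.prod ν) = ∫⁻ y, (partialIntegral h μ y : ℝ≥0∞) ∂ν := by
  simp_rw [coe_partialIntegral]
  exact lintegral_prod_symm' _ (measurable_coe_prod h)

lemma partialIntegral_mono {h h' : C_c(X × Y, ℝ≥0)} (hh : h ≤ h') (μ : Measure X)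
    [IsFiniteMeasure μ] (y : Y) : (partialIntegral h μ y : ℝ≥0∞) ≤ partialIntegral h' μ y := by
  simp_rw [coe_partialIntegral]
  exact lintegral_mono fun x => ENNReal.coe_le_coe.2 (hh (x, y))

variable [T2Space X] [LocallyCompactSpace X] [LocallyCompactSpace Y]

/-- Sections of minorants of `k` suffice to compute the potential, so one directed family,
independent of `y`, serves all points. -/
lemma potential_eq_iSup {k : X × Y → ℝ≥0∞} (hk : LowerSemicontinuous k)
    (μ : Measure X) [IsFiniteMeasure μ] (y : Y) :
    potential k μ y = ⨆ h : Minorant k, (partialIntegral h.1 μ y : ℝ≥0∞) := by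
  apply le_antisymm
  · have : (fun x => k (x, y)) = fun x => ⨆ h : Minorant k, (h.1 (x, y) : ℝ≥0∞) := by
      ext x
      rw [iSup_minorant hk]
    simp_rw [potential, this, coe_partialIntegral]
    refine upperIntegral_iSup_le μ (fun h => ?_) (Monotone.directed_le fun h h' hh x => ?_)
    · exact (by fun_prop : Continuous fun x => (h.1 (x, y) : ℝ≥0∞)).lowerSemicontinuous
    · exact ENNReal.coe_le_coe.2 (hh (x, y))
  · refine iSup_le fun h => ?_
    rw [coe_partialIntegral]
    exact le_iSup₂_of_le (f := fun (p : C_c(X, ℝ≥0)) (_ : ∀ x, (p x : ℝ≥0∞) ≤ k (x, y)) =>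
      ∫⁻ x, (p x : ℝ≥0∞) ∂μ) (slice h.1 y) (fun x => h.2 (x, y)) le_rfl

/-- Fubini's theorem for the upper integral of a kernel. -/
lemma upperIntegral_potential [MeasurableSpace Y] [OpensMeasurableSpace Y] {k : X × Y → ℝ≥0∞}
    (hk : LowerSemicontinuous k) (μ : Measure X) (ν : Measure Y) [IsFiniteMeasure μ]
    [IsFiniteMeasure ν] : upperIntegral ν (potential k μ) = energy k μ ν := by
  rw [energy, upperIntegral_eq_iSup (μ.prod ν)]
  simp_rw [lintegral_prod_eq]
  apply le_antisymm
  · rw [funext (potential_eq_iSup hk μ)]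
    refine upperIntegral_iSup_le ν (fun h => ?_) (Monotone.directed_le fun h h' hh y => ?_)
    · exact (by fun_prop : Continuous fun y =>
        (partialIntegral h.1 μ y : ℝ≥0∞)).lowerSemicontinuous
    · exact partialIntegral_mono hh μ y
  · refine iSup_le fun h => le_iSup₂_of_le
      (f := fun (p : C_c(Y, ℝ≥0)) (_ : ∀ y, (p y : ℝ≥0∞) ≤ potential k μ y) =>
        ∫⁻ y, (p y : ℝ≥0∞) ∂ν) (partialIntegral h.1 μ) (fun y => ?_) le_rfl
    rw [potential_eq_iSup hk]
    exact le_iSup (fun h : Minorant k => (partialIntegral h.1 μ y : ℝ≥0∞)) h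

end Slice

lemma energy_comm {X : Type*} [TopologicalSpace X] [MeasurableSpace X] [OpensMeasurableSpace X]
    {k : X × X → ℝ≥0∞} (hk : ∀ x y, k (x, y) = k (y, x)) (μ ν : Measure X) [SFinite μ]
    [SFinite ν] : energy k μ ν = energy k ν μ := by
  have key : ∀ (μ ν : Measure X) [SFinite μ] [SFinite ν], energy k μ ν ≤ energy k ν μ := by
    intro μ ν _ _
    refine iSup₂_le fun h hh => ?_
    refine le_iSup₂_of_le
      (f := fun (p : C_c(X × X, ℝ≥0)) (_ : ∀ z, (p z : ℝ≥0∞) ≤ k z) =>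
        ∫⁻ z, (p z : ℝ≥0∞) ∂(ν.prod μ))
      ⟨⟨fun z => h z.swap, h.continuous.comp continuous_swap⟩,
        h.hasCompactSupport.comp_isClosedEmbedding (Homeomorph.prodComm X X).isClosedEmbedding⟩
      (fun z => (hh z.swap).trans (hk _ _).le) ?_
    rw [← Measure.prod_swap, lintegral_map (measurable_coe_prod h) measurable_swap]
    exact le_rfl
  exact le_antisymm (key μ ν) (key ν μ)

/-! ### Separation and the abstract minimax inequality -/

section Minimax

/-- A convex set in `ℝ^ι` that misses the open orthant `{x | ∀ i, x i < c}` lies on one side of a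
hyperplane with nonnegative normal vector through the corner of the orthant. -/
lemma exists_weights_of_convex {ι : Type*} [Fintype ι] {T : Set (ι → ℝ)} (hT : Convex ℝ T)
    (hne : T.Nonempty) {c : ℝ} (h : ∀ x ∈ T, ∃ i, c ≤ x i) :
    ∃ w : ι → ℝ≥0, 0 < ∑ i, w i ∧ ∀ x ∈ T, c * ∑ i, (w i : ℝ) ≤ ∑ i, (w i : ℝ) * x i := by
  classical
  have hOconv : Convex ℝ (univ.pi fun _ : ι => Iio c) := convex_pi fun _ _ => convex_Iio c
  have hOopen : IsOpen (univ.pi fun _ : ι => Iio c) := isOpen_set_pi finite_univ fun _ _ => isOpen_Iio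
  obtain ⟨f, u, hfu, hfT⟩ := geometric_hahn_banach_open hOconv hOopen hT (by
    rw [Set.disjoint_left]
    intro x hx hxT
    obtain ⟨i, hi⟩ := h x hxT
    exact absurd (hx i (mem_univ i)) (not_lt.2 hi))
  have hf : ∀ x, f x = ∑ i, f (Pi.single i 1) * x i := by
    intro x
    conv_lhs => rw [pi_eq_sum_univ' x]
    simp [map_sum, mul_comm]
  have hconst : ∀ t : ℝ, t < c → (∑ i, f (Pi.single i 1)) * t < u := by
    intro t ht
    have := hfu (fun _ => t) (by simpa using fun _ => ht)
    rwa [hf, ← Finset.sum_mul] at this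
  have hnonneg : ∀ i, 0 ≤ f (Pi.single i 1) := by
    intro i
    by_contra! hi
    set a := f (Pi.single i 1)
    set d := f fun _ => c - 1
    -- Moving this far along `-e_i` stays in the orthant, yet a negative coefficient `a` would raise
    -- `f` to `d + |u - d| ≥ u`.
    have ht : 0 ≤ |u - d| / (-a) := by
      have : 0 < -a := by linarith
      positivity
    have := hfu ((fun _ => c - 1) - (|u - d| / (-a)) • Pi.single i 1) (by
      simp only [mem_univ_pi, mem_Iio, Pi.sub_apply, Pi.smul_apply, smul_eq_mul]
      intro j
      have : (0 : ℝ) ≤ (Pi.single i 1 : ι → ℝ) j := by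
        rw [Pi.single_apply]; split_ifs <;> simp
      have := mul_nonneg ht this
      linarith)
    rw [map_sub, map_smul, smul_eq_mul] at this
    have h2 : |u - d| / (-a) * a = -|u - d| := by
      rw [div_neg, neg_mul, div_mul_cancel₀ _ hi.ne]
    have h3 := le_abs_self (u - d)
    change d - |u - d| / (-a) * a < u at this
    linarith
  have hle : (∑ i, f (Pi.single i 1)) * c ≤ u := by
    have h1 : Filter.Tendsto (fun t => (∑ i, f (Pi.single i 1)) * t) (nhdsWithin c (Iio c))
        (nhds ((∑ i, f (Pi.single i 1)) * c)) :=
      ((continuous_const.mul continuous_id).tendsto c).mono_left nhdsWithin_le_nhds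
    exact le_of_tendsto h1 (by
      filter_upwards [self_mem_nhdsWithin] with t ht using (hconst t ht).le)
  refine ⟨fun i => ⟨f (Pi.single i 1), hnonneg i⟩, ?_, fun x hx => ?_⟩
  -- With all weights zero, `f = 0`, and the separation would give both `0 < u` and `u ≤ 0`.
  · rw [pos_iff_ne_zero]
    intro h0
    have hzero : ∀ i, f (Pi.single i 1) = 0 := by
      intro i
      have := (Finset.sum_eq_zero_iff.1 h0) i (Finset.mem_univ i)
      exact congrArg NNReal.toReal this
    obtain ⟨x, hx⟩ := hne
    have h1 := hfT x hx
    have h2 := hconst (c - 1) (by linarith)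
    rw [hf] at h1
    simp only [hzero, zero_mul, Finset.sum_const_zero] at h1 h2
    linarith
  · have h1 := hfT x hx
    rw [hf] at h1
    change c * ∑ i, f (Pi.single i 1) ≤ ∑ i, f (Pi.single i 1) * x i
    linarith

/-- A nonnegative combination of points of a convex set is a multiple of a point of the set. -/
lemma exists_sum_smul_eq {M ι : Type*} [AddCommMonoid M] [Module ℝ≥0 M] {s : Set M}
    (hs : Convex ℝ≥0 s) {z : ι → M} (hz : ∀ i, z i ∈ s) (w : ι → ℝ≥0) (t : Finset ι)
    (hw : 0 < ∑ i ∈ t, w i) : ∃ x ∈ s, ∑ i ∈ t, w i • z i = (∑ i ∈ t, w i) • x := by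
  classical
  induction t using Finset.induction_on with
  | empty => simp at hw
  | insert a t ha ih =>
    rw [Finset.sum_insert ha] at hw
    simp only [Finset.sum_insert ha]
    rcases eq_or_ne (∑ i ∈ t, w i) 0 with h0 | h0
    · refine ⟨z a, hz a, ?_⟩
      rw [h0, add_zero, Finset.sum_eq_zero, add_zero]
      intro i hi
      rw [Finset.sum_eq_zero_iff.1 h0 i hi, zero_smul]
    · obtain ⟨x, hx, hxe⟩ := ih (pos_iff_ne_zero.2 h0)
      set W := ∑ i ∈ t, w i
      refine ⟨(w a / (w a + W)) • z a + (W / (w a + W)) • x,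
        hs (hz a) hx zero_le zero_le (by rw [← add_div, div_self hw.ne']), ?_⟩
      rw [hxe, smul_add, smul_smul, smul_smul, mul_div_cancel₀ _ hw.ne', mul_div_cancel₀ _ hw.ne']

/-- Minimax inequality for the supremum of a directed family of biaffine functions that are lower
semicontinuous in the second variable, over a compact set. -/
lemma iInf_iSup_le_iSup_iInf {M N ι : Type*} [AddCommMonoid M] [Module ℝ≥0 M]
    [AddCommMonoid N] [Module ℝ≥0 N] [TopologicalSpace N] [Nonempty ι]
    {R : Set M} {T : Set N} (hR : Convex ℝ≥0 R) (hT : Convex ℝ≥0 T) (hTc : IsCompact T)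
    (hne : R.Nonempty ∨ T.Nonempty)
    (B : ι → M → N → ℝ≥0∞) (hdir : Directed (· ≤ ·) B)
    (hfin : ∀ i, ∀ μ ∈ R, ∀ ν ∈ T, B i μ ν ≠ ∞)
    (hadd_left : ∀ i μ μ' ν, B i (μ + μ') ν = B i μ ν + B i μ' ν)
    (hsmul_left : ∀ i (a : ℝ≥0) μ ν, B i (a • μ) ν = a * B i μ ν)
    (hright : ∀ i, ∀ μ ∈ R, ∀ ν ∈ T, ∀ ν' ∈ T, ∀ a b : ℝ≥0,
      B i μ (a • ν + b • ν') = a * B i μ ν + b * B i μ ν')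
    (hlsc : ∀ i, ∀ μ ∈ R, LowerSemicontinuousOn (B i μ) T) :
    (⨅ ν ∈ T, ⨆ μ ∈ R, ⨆ i, B i μ ν) ≤ ⨆ μ ∈ R, ⨅ ν ∈ T, ⨆ i, B i μ ν := by
  classical
  -- For empty `T` the left side is `∞`; the right side is too only because `R` is then nonempty.
  rcases T.eq_empty_or_nonempty with rfl | hTne
  · obtain ⟨μ, hμ⟩ := hne.resolve_right (by simp)
    exact le_iSup₂_of_le μ hμ (by simp)
  refine ENNReal.le_of_forall_nnreal_lt fun c hc => ?_
  obtain ⟨F, hF⟩ : ∃ F : Finset (ι × R), ∀ ν ∈ T, ∃ p ∈ F, (c : ℝ≥0∞) < B p.1 p.2 ν := by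
    have hex : ∀ ν ∈ T, ∃ p : ι × R, (c : ℝ≥0∞) < B p.1 p.2 ν := by
      intro ν hν
      have := hc.trans_le (iInf₂_le ν hν)
      simp only [lt_iSup_iff] at this
      obtain ⟨μ, hμ, i, h⟩ := this
      exact ⟨(i, ⟨μ, hμ⟩), h⟩
    choose p hp using hex
    obtain ⟨t, ht⟩ := hTc.elim_nhdsWithin_subcover'
      (fun ν hν => {ν' | (c : ℝ≥0∞) < B (p ν hν).1 (p ν hν).2 ν'})
      (fun ν hν => hlsc _ _ (p ν hν).2.2 ν hν c (hp ν hν))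
    refine ⟨t.image fun ν => p ν.1 ν.2, fun ν hν => ?_⟩
    obtain ⟨ν', hν', h⟩ := mem_iUnion₂.1 (ht hν)
    exact ⟨_, Finset.mem_image_of_mem _ hν', h⟩
  obtain ⟨i, hi⟩ : ∃ i, ∀ p ∈ F, B p.1 ≤ B i := by
    obtain ⟨i, hi⟩ := hdir.finset_le (F.image Prod.fst)
    exact ⟨i, fun p hp => hi p.1 (Finset.mem_image_of_mem _ hp)⟩
  have hF' : ∀ ν ∈ T, ∃ p : F, (c : ℝ≥0∞) < B i p.1.2 ν := fun ν hν =>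
    let ⟨p, hp, hlt⟩ := hF ν hν
    ⟨⟨p, hp⟩, hlt.trans_le (hi p hp _ _)⟩
  -- The image of `T` under `G` is convex since `B i` is affine in `ν`, and by `hF'` it misses the
  -- open orthant below `c`.
  let G : N → F → ℝ := fun ν p => (B i p.1.2 ν).toReal
  obtain ⟨w, hw, hwle⟩ := exists_weights_of_convex (T := G '' T) (c := c) (by
      rintro _ ⟨ν, hν, rfl⟩ _ ⟨ν', hν', rfl⟩ a b ha hb hab
      lift a to ℝ≥0 using ha
      lift b to ℝ≥0 using hb
      refine ⟨a • ν + b • ν', hT hν hν' zero_le zero_le (by exact_mod_cast hab), ?_⟩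
      ext p
      have hp := p.1.2.2
      simp only [G, Pi.add_apply, Pi.smul_apply, smul_eq_mul]
      rw [hright i _ hp ν hν ν' hν', ENNReal.toReal_add
        (ENNReal.mul_ne_top ENNReal.coe_ne_top (hfin i _ hp ν hν))
        (ENNReal.mul_ne_top ENNReal.coe_ne_top (hfin i _ hp ν' hν'))]
      simp) (hTne.image G) (by
      rintro _ ⟨ν, hν, rfl⟩
      obtain ⟨p, hp⟩ := hF' ν hν
      exact ⟨p, by simpa using ENNReal.toReal_mono (hfin i _ p.1.2.2 ν hν) hp.le⟩)
  obtain ⟨μ, hμ, hμe⟩ := exists_sum_smul_eq hR (z := fun p : F => (p.1.2 : M))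
    (fun p => p.1.2.2) w Finset.univ hw
  refine le_iSup₂_of_le μ hμ (le_iInf₂ fun ν hν => le_iSup_of_le i ?_)
  have hsum : ∀ t : Finset F, t.Nonempty → B i (∑ p ∈ t, w p • (p.1.2 : M)) ν =
      ∑ p ∈ t, (w p : ℝ≥0∞) * B i p.1.2 ν := by
    intro t ht
    induction ht using Finset.Nonempty.cons_induction with
    | singleton a => simp [hsmul_left]
    | cons a t ha _ ih => rw [Finset.sum_cons, Finset.sum_cons, hadd_left, hsmul_left, ih]
  obtain ⟨p₀, -⟩ := hF' ν hν
  have h1 := hsum Finset.univ ⟨p₀, Finset.mem_univ _⟩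
  rw [hμe, hsmul_left] at h1
  have h2 := hwle _ ⟨ν, hν, rfl⟩
  have h3 : ∑ p, (w p : ℝ) * G ν p = (∑ p, (w p : ℝ≥0∞) * B i p.1.2 ν).toReal := by
    rw [ENNReal.toReal_sum fun p _ =>
      ENNReal.mul_ne_top ENNReal.coe_ne_top (hfin i _ p.1.2.2 ν hν)]
    simp [G]
  rw [h3, ← h1, ENNReal.toReal_mul, ENNReal.coe_toReal, mul_comm, ← NNReal.coe_sum] at h2
  have h4 := le_of_mul_le_mul_left h2 (by exact_mod_cast hw)
  rw [← ENNReal.ofReal_coe_nnreal]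
  exact ENNReal.ofReal_le_of_le_toReal h4

end Minimax

/-! ### Vague continuity and minimax for the energy -/

section Energy

variable {X Y : Type*} [TopologicalSpace X] [MeasurableSpace X] [OpensMeasurableSpace X]
  [TopologicalSpace Y] [MeasurableSpace Y] [OpensMeasurableSpace Y] [T2Space Y]

lemma lintegral_eq_ofReal_integral {Z : Type*} [TopologicalSpace Z] [MeasurableSpace Z]
    [OpensMeasurableSpace Z] (μ : Measure Z) [IsFiniteMeasure μ] (h : C_c(Z, ℝ≥0)) :
    ∫⁻ z, (h z : ℝ≥0∞) ∂μ = ENNReal.ofReal (∫ z, h.toReal z ∂μ) := by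
  have hm : AEMeasurable (fun z => (h z : ℝ≥0∞)) μ :=
    (by fun_prop : Continuous fun z => (h z : ℝ≥0∞)).measurable.aemeasurable
  have := integral_toReal hm (by simp)
  simp only [ENNReal.coe_toReal] at this
  simp only [CompactlySupportedContinuousMap.toReal_apply]
  rw [this, ENNReal.ofReal_toReal (lintegral_coe_lt_top μ h).ne]

/-- On finite measures, integration of a compactly supported function is vaguely continuous. -/
lemma continuousOn_lintegral_vague (h : C_c(X, ℝ≥0)) {T : Set (Measure X)}
    (hT : T ⊆ finiteRadon X) :
    @ContinuousOn _ _ (vagueTopology X) _ (fun ν : Measure X => ∫⁻ x, (h x : ℝ≥0∞) ∂ν) T := by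
  let _ := vagueTopology X
  have h1 : Continuous fun ν : Measure X => ENNReal.ofReal (∫ x, h.toReal x ∂ν) :=
    ENNReal.continuous_ofReal.comp ((continuous_apply h.toReal).comp
      (continuous_induced_dom (f := fun (ν : Measure X) (f : C_c(X, ℝ)) => ∫ x, f x ∂ν)))
  refine h1.continuousOn.congr fun ν hν => ?_
  have := (hT hν).2
  exact lintegral_eq_ofReal_integral ν h

/-- The minimax theorem for the mutual energy. -/
theorem minimax_energy (k : X × Y → ℝ≥0∞) {R : Set (Measure X)} {T : Set (Measure Y)}
    (hR : R ⊆ finiteRadon X) (hT : T ⊆ finiteRadon Y) (hR_convex : Convex ℝ≥0 R)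
    (hT_convex : Convex ℝ≥0 T) (hT_compact : IsVaguelyCompact T)
    (hne : R.Nonempty ∨ T.Nonempty) :
    (⨆ μ ∈ R, ⨅ ν ∈ T, energy k μ ν) = ⨅ ν ∈ T, ⨆ μ ∈ R, energy k μ ν := by
  let _ := vagueTopology Y
  refine le_antisymm ?_ ?_
  · exact iSup₂_le fun μ hμ => le_iInf₂ fun ν hν =>
      (iInf₂_le ν hν).trans (le_iSup₂ (f := fun μ (_ : μ ∈ R) => energy k μ ν) μ hμ)
  -- The iterated integral, unlike `μ.prod ν`, is additive in `μ` for arbitrary measures; `hB'`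
  -- reverses the order, which displays vague continuity in `ν`.
  let B : Minorant k → Measure X → Measure Y → ℝ≥0∞ := fun h μ ν =>
    ∫⁻ x, ∫⁻ y, (h.1 (x, y) : ℝ≥0∞) ∂ν ∂μ
  have hfinR : ∀ μ ∈ R, IsFiniteMeasure μ := fun μ hμ => (hR hμ).2
  have hfinT : ∀ ν ∈ T, IsFiniteMeasure ν := fun ν hν => (hT hν).2
  have hB : ∀ h, ∀ μ ∈ R, ∀ ν ∈ T, B h μ ν = ∫⁻ z, (h.1 z : ℝ≥0∞) ∂(μ.prod ν) := by
    intro h μ hμ ν hν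
    have := hfinR μ hμ
    have := hfinT ν hν
    exact (lintegral_prod _ (measurable_coe_prod h.1).aemeasurable).symm
  have hB' : ∀ h, ∀ μ (hμ : μ ∈ R), ∀ ν ∈ T, B h μ ν =
      ∫⁻ y, ((haveI := hfinR μ hμ; partialIntegral h.1 μ y : ℝ≥0) : ℝ≥0∞) ∂ν := by
    intro h μ hμ ν hν
    have := hfinR μ hμ
    have := hfinT ν hν
    rw [hB h μ hμ ν hν, lintegral_prod_eq]
  have hE : ∀ μ ∈ R, ∀ ν ∈ T, energy k μ ν = ⨆ h, B h μ ν := by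
    intro μ hμ ν hν
    rw [energy, upperIntegral_eq_iSup]
    exact iSup_congr fun h => (hB h μ hμ ν hν).symm
  have h1 : (⨅ ν ∈ T, ⨆ μ ∈ R, energy k μ ν) = ⨅ ν ∈ T, ⨆ μ ∈ R, ⨆ h, B h μ ν :=
    biInf_congr fun ν hν => biSup_congr fun μ hμ => hE μ hμ ν hν
  have h2 : (⨆ μ ∈ R, ⨅ ν ∈ T, energy k μ ν) = ⨆ μ ∈ R, ⨅ ν ∈ T, ⨆ h, B h μ ν :=
    biSup_congr fun μ hμ => biInf_congr fun ν hν => hE μ hμ ν hν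
  rw [h1, h2]
  refine iInf_iSup_le_iSup_iInf hR_convex hT_convex hT_compact hne B
    (Monotone.directed_le fun h h' hh μ ν => lintegral_mono fun x => lintegral_mono fun y =>
      ENNReal.coe_le_coe.2 ((Subtype.coe_le_coe.2 hh) (x, y))) ?_ ?_ ?_ ?_ ?_
  · intro h μ hμ ν hν
    have := hfinR μ hμ
    have := hfinT ν hν
    rw [hB' h μ hμ ν hν]
    exact (lintegral_coe_lt_top ν _).ne
  · exact fun h μ μ' ν => lintegral_add_measure _ _ _
  · intro h a μ ν
    exact lintegral_smul_measure _ _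
  · intro h μ hμ ν hν ν' hν' a b
    have := hfinR μ hμ
    have := hfinT ν hν
    have := hfinT ν' hν'
    have hm : ∀ ν : Measure Y, IsFiniteMeasure ν →
        Measurable fun x => ∫⁻ y, (h.1 (x, y) : ℝ≥0∞) ∂ν :=
      fun ν _ => (measurable_coe_prod h.1).lintegral_prod_right'
    simp only [B, lintegral_add_measure, lintegral_smul_measure]
    simp only [ENNReal.smul_def, smul_eq_mul]
    rw [lintegral_add_left ((hm ν ‹_›).const_mul _),
      lintegral_const_mul _ (hm ν ‹_›), lintegral_const_mul _ (hm ν' ‹_›)]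
  · intro h μ hμ
    have := hfinR μ hμ
    refine ((continuousOn_lintegral_vague (partialIntegral h.1 μ) hT).congr
      fun ν hν => hB' h μ hμ ν hν).lowerSemicontinuousOn

end Energy

end RadonEnergy

end

theorem theorem1 {X : Type*} [TopologicalSpace X] [LocallyCompactSpace X] [T2Space X]
    [MeasurableSpace X] [BorelSpace X]
    (k : X × X → ℝ≥0∞) (hk_lsc : LowerSemicontinuous k) (hk_symm : ∀ x y, k (x, y) = k (y, x))
    (H L : Set X) (R S R' S' : Set (Measure X))
    (hR : R ⊆ RadonEnergy.measuresOn H) (hS : S ⊆ RadonEnergy.measuresOn H)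
    (hR' : R' ⊆ RadonEnergy.measuresOn L) (hS' : S' ⊆ RadonEnergy.measuresOn L)
    (hR_convex : Convex ℝ≥0 R) (hS_convex : Convex ℝ≥0 S)
    (hR'_convex : Convex ℝ≥0 R') (hS'_convex : Convex ℝ≥0 S')
    (hR'_compact : RadonEnergy.IsVaguelyCompact R')
    (hS'_compact : RadonEnergy.IsVaguelyCompact S')
    (hne : R.Nonempty ∨ R'.Nonempty)
    (h_inf : ∀ μ ∈ RadonEnergy.measuresOn H,
      (⨅ ν ∈ R', RadonEnergy.upperIntegral ν (RadonEnergy.potential k μ)) =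
        (⨅ ν ∈ S', RadonEnergy.upperIntegral ν (RadonEnergy.potential k μ)))
    (h_sup : ∀ μ ∈ RadonEnergy.measuresOn L,
      (⨆ ν ∈ R, RadonEnergy.upperIntegral ν (RadonEnergy.potential k μ)) =
        (⨆ ν ∈ S, RadonEnergy.upperIntegral ν (RadonEnergy.potential k μ))) :
    RadonEnergy.supInfEnergy k R S' = RadonEnergy.infSupEnergy k R' S := by
  have hfinH : ∀ μ ∈ RadonEnergy.measuresOn H, IsFiniteMeasure μ := fun μ hμ => hμ.1.2
  have hfinL : ∀ μ ∈ RadonEnergy.measuresOn L, IsFiniteMeasure μ := fun μ hμ => hμ.1.2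
  have hpot : ∀ μ ν : Measure X, IsFiniteMeasure μ → IsFiniteMeasure ν →
      RadonEnergy.upperIntegral ν (RadonEnergy.potential k μ) = RadonEnergy.energy k μ ν :=
    fun μ ν _ _ => RadonEnergy.upperIntegral_potential hk_lsc μ ν
  have hinf : ∀ μ ∈ R, (⨅ ν ∈ S', RadonEnergy.energy k μ ν) =
      ⨅ ν ∈ R', RadonEnergy.energy k μ ν := by
    intro μ hμ
    have h1 : (⨅ ν ∈ R', RadonEnergy.upperIntegral ν (RadonEnergy.potential k μ)) =
        ⨅ ν ∈ R', RadonEnergy.energy k μ ν :=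
      biInf_congr fun ν hν => hpot μ ν (hfinH μ (hR hμ)) (hfinL ν (hR' hν))
    have h2 : (⨅ ν ∈ S', RadonEnergy.upperIntegral ν (RadonEnergy.potential k μ)) =
        ⨅ ν ∈ S', RadonEnergy.energy k μ ν :=
      biInf_congr fun ν hν => hpot μ ν (hfinH μ (hR hμ)) (hfinL ν (hS' hν))
    rw [← h1, ← h2, h_inf μ (hR hμ)]
  -- Here symmetry of `k` enters: (2) concerns `E(ν, μ)`, the minimax theorem `E(μ, ν)`.
  have hsup : ∀ ν ∈ R', (⨆ μ ∈ S, RadonEnergy.energy k ν μ) =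
      ⨆ μ ∈ R, RadonEnergy.energy k μ ν := by
    intro ν hν
    have hν_fin := hfinL ν (hR' hν)
    have h1 : (⨆ μ ∈ R, RadonEnergy.upperIntegral μ (RadonEnergy.potential k ν)) =
        ⨆ μ ∈ R, RadonEnergy.energy k μ ν := biSup_congr fun μ hμ => by
      have := hfinH μ (hR hμ)
      rw [hpot ν μ hν_fin this, RadonEnergy.energy_comm hk_symm]
    have h2 : (⨆ μ ∈ S, RadonEnergy.upperIntegral μ (RadonEnergy.potential k ν)) =
        ⨆ μ ∈ S, RadonEnergy.energy k ν μ :=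
      biSup_congr fun μ hμ => hpot ν μ hν_fin (hfinH μ (hS hμ))
    rw [← h1, ← h2, h_sup ν (hR' hν)]
  rw [RadonEnergy.supInfEnergy, RadonEnergy.infSupEnergy, biSup_congr hinf, biInf_congr hsup]
  exact RadonEnergy.minimax_energy k (fun μ hμ => (hR hμ).1) (fun ν hν => (hR' hν).1)
    hR_convex hR'_convex hR'_compact hne
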